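/- A (finite) two-player game consists of finite strategy sets $S_1,S_2$ and a utility function $u=(u_1,u_2):S_1\times S_2\to\mathbb{R}^2$; it is zero-sum if $u_1+u_2=0$ at every profile. Its response graph is the directed graph on the set $S_1\times S_2$ of pure profiles with an arc $p\to q$ if and only if $p$ and $q$ differ in the strategy of exactly one player $i$ and $u_i(p)\le u_i(q)$. An interior Nash equilibrium is a mixed Nash equilibrium in which each player plays each of their strategies with positive probability. The Inner Diamond graph is the directed graph on $\{0,1,2\}\times\{0,1,2\}$ (row, column) in which distinct vertices are joined by an arc (in exactly one direction) if and only if they share a row or a column, the arcs being directed from earlier to later vertices in the following orders: in row $0$ the columns are ordered $0,1,2$; in row $1$: $0,2,1$; in row $2$: $2,1,0$; in column $0$ the rows are ordered $2,1,0$; in column $1$: $0,2,1$; in column $2$: $0,1,2$. (The vertex $(1,1)$ is a sink.) The Outer Diamond graph is obtained from the Inner Diamond graph by reversing all arcs. (The vertex $(1,1)$ is then a source.) Lemma. No two-player zero-sum game that has an interior Nash equilibrium has a response graph isomorphic (as a directed graph) to the Inner Diamond graph or to the Outer Diamond graph. -/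

import Mathlib

namespace GameTheory

/-- A (pure) profile: a choice of one strategy for each player. -/
abbrev Profile {ι : Type*} (S : ι → Type*) := (i : ι) → S i

/-- Two profiles are `i`-comparable if they differ in the strategy of player `i` and only there. -/
def Comparable {ι : Type*} {S : ι → Type*} (i : ι) (p q : Profile S) : Prop :=
  p i ≠ q i ∧ ∀ j, j ≠ i → p j = q j

/-- The response graph of the game with utility function `u : Profile S → ι → ℝ`: there is an arc
from `p` to `q` iff they are `i`-comparable for some player `i`, who weakly prefers `q` to `p`. -/
def responseGraph {ι : Type*} {S : ι → Type*} (u : Profile S → ι → ℝ) : Digraph (Profile S) where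
  Adj p q := ∃ i, Comparable i p q ∧ u p i ≤ u q i

/-- The payoffs sum to zero at every profile. -/
def IsZeroSum {ι : Type*} [Fintype ι] {S : ι → Type*} (u : Profile S → ι → ℝ) : Prop :=
  ∀ p, ∑ i, u p i = 0

/-- A mixed profile: each player is assigned a probability distribution over their strategies. -/
def IsMixedProfile {ι : Type*} {S : ι → Type*} [∀ i, Fintype (S i)] (x : (i : ι) → S i → ℝ) :
    Prop :=
  ∀ i, x i ∈ stdSimplex ℝ (S i)

/-- Expected utility of player `i` under the mixed profile `x`. -/
noncomputable def expectedUtility {ι : Type*} [Fintype ι] [DecidableEq ι] {S : ι → Type*}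
    [∀ i, Fintype (S i)] (u : Profile S → ι → ℝ) (x : (i : ι) → S i → ℝ) (i : ι) : ℝ :=
  ∑ q : Profile S, u q i * ∏ j, x j (q j)

/-- A mixed Nash equilibrium: no player gains by a unilateral deviation to a mixed strategy. -/
def IsNashEquilibrium {ι : Type*} [Fintype ι] [DecidableEq ι] {S : ι → Type*}
    [∀ i, Fintype (S i)] (u : Profile S → ι → ℝ) (x : (i : ι) → S i → ℝ) : Prop :=
  IsMixedProfile x ∧ ∀ i, ∀ y ∈ stdSimplex ℝ (S i),
    expectedUtility u (Function.update x i y) i ≤ expectedUtility u x i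

/-- A Nash equilibrium in the (relative) interior of the strategy space: every strategy of every
player is played with positive probability. -/
def IsInteriorNashEquilibrium {ι : Type*} [Fintype ι] [DecidableEq ι] {S : ι → Type*}
    [∀ i, Fintype (S i)] (u : Profile S → ι → ℝ) (x : (i : ι) → S i → ℝ) : Prop :=
  IsNashEquilibrium u x ∧ ∀ i s, 0 < x i s

/-- The arcs of the Inner Diamond graph on the 3×3 grid of (row, column) pairs. Within each row and
each column they form a transitive tournament. The vertex `(1, 1)` is a sink. -/
def innerDiamondArcs : Finset ((Fin 3 × Fin 3) × (Fin 3 × Fin 3)) :=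
  { -- row 0, in the order 0, 1, 2
    ((0, 0), (0, 1)), ((0, 1), (0, 2)), ((0, 0), (0, 2)),
    -- row 1, in the order 0, 2, 1
    ((1, 0), (1, 2)), ((1, 2), (1, 1)), ((1, 0), (1, 1)),
    -- row 2, in the order 2, 1, 0
    ((2, 2), (2, 1)), ((2, 1), (2, 0)), ((2, 2), (2, 0)),
    -- column 0, in the order 2, 1, 0
    ((2, 0), (1, 0)), ((1, 0), (0, 0)), ((2, 0), (0, 0)),
    -- column 1, in the order 0, 2, 1
    ((0, 1), (2, 1)), ((2, 1), (1, 1)), ((0, 1), (1, 1)),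
    -- column 2, in the order 0, 1, 2
    ((0, 2), (1, 2)), ((1, 2), (2, 2)), ((0, 2), (2, 2)) }

/-- The Inner Diamond graph. -/
def innerDiamond : Digraph (Fin 3 × Fin 3) where
  Adj p q := (p, q) ∈ innerDiamondArcs

/-- The Outer Diamond graph: the Inner Diamond graph with all arcs reversed, so that `(1, 1)` is
a source. -/
def outerDiamond : Digraph (Fin 3 × Fin 3) where
  Adj p q := (q, p) ∈ innerDiamondArcs

/-- Isomorphism of directed graphs. -/
def DigraphIsomorphic {V W : Type*} (G : Digraph V) (H : Digraph W) : Prop :=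
  ∃ f : V ≃ W, ∀ a b, G.Adj a b ↔ H.Adj (f a) (f b)

end GameTheory

namespace GameTheory

/-! Only the sink `(1, 1)` and one arc into it matter. At a sink `p` every deviation strictly hurts
the deviator, so by zero-sum it strictly helps the opponent. Hence each player's strategy in `p`
guarantees at least their payoff at `p`, and strictly more against a fully mixed opponent who has an
alternative. Interior equilibrium makes each pure strategy earn the equilibrium payoff, so these
bounds sum to `0 < 0` (`IsZeroSum.not_comparable_of_forall_lt`). A source of `u` is handled as a
strict local maximum of `-u`. -/

lemma Comparable.symm {ι : Type*} {S : ι → Type*} {i : ι} {p q : Profile S}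
    (h : Comparable i p q) : Comparable i q p :=
  ⟨h.1.symm, fun j hj => (h.2 j hj).symm⟩

lemma IsZeroSum.neg {ι : Type*} [Fintype ι] {S : ι → Type*} {u : Profile S → ι → ℝ}
    (hu : IsZeroSum u) : IsZeroSum (-u) := by
  intro p
  simp [hu p]

lemma prod_update_apply {ι : Type*} [Fintype ι] [DecidableEq ι] {S : ι → Type*}
    (x : (i : ι) → S i → ℝ) (i : ι) (y : S i → ℝ) (q : Profile S) :
    ∏ j, Function.update x i y j (q j) = y (q i) * ∏ j ∈ Finset.univ.erase i, x j (q j) := by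
  rw [← Finset.mul_prod_erase _ _ (Finset.mem_univ i), Function.update_self]
  congr 1
  refine Finset.prod_congr rfl fun j hj => ?_
  rw [Function.update_of_ne (Finset.ne_of_mem_erase hj)]

lemma IsMixedProfile.update {ι : Type*} [DecidableEq ι] {S : ι → Type*} [∀ i, Fintype (S i)]
    {x : (i : ι) → S i → ℝ} (hx : IsMixedProfile x) (i : ι) {y : S i → ℝ}
    (hy : y ∈ stdSimplex ℝ (S i)) : IsMixedProfile (Function.update x i y) := by
  intro j
  obtain rfl | h := eq_or_ne j i
  · rwa [Function.update_self]
  · rw [Function.update_of_ne h]; exact hx j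

section General

variable {ι : Type*} [Fintype ι] [DecidableEq ι] {S : ι → Type*} [∀ i, Fintype (S i)]

/-- Expected utility is the average of the expected utilities of the pure deviations. -/
lemma expectedUtility_update [∀ i, DecidableEq (S i)] (u : Profile S → ι → ℝ)
    (x : (i : ι) → S i → ℝ) (i k : ι) (y : S i → ℝ) :
    expectedUtility u (Function.update x i y) k =
      ∑ s, y s * expectedUtility u (Function.update x i (Pi.single s 1)) k := by
  simp only [expectedUtility, prod_update_apply, Finset.mul_sum]
  rw [Finset.sum_comm]
  refine Finset.sum_congr rfl fun q _ => ?_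
  rw [Finset.sum_eq_single (q i)]
  · rw [Pi.single_eq_same]; ring
  · intro s _ hs
    rw [Pi.single_eq_of_ne hs.symm]; ring
  · simp

/-- In an interior equilibrium, each player is indifferent between all their pure strategies. -/
lemma IsInteriorNashEquilibrium.expectedUtility_update_single [∀ i, DecidableEq (S i)]
    {u : Profile S → ι → ℝ} {x : (i : ι) → S i → ℝ} (hx : IsInteriorNashEquilibrium u x)
    (i : ι) (s : S i) :
    expectedUtility u (Function.update x i (Pi.single s 1)) i = expectedUtility u x i := by
  obtain ⟨⟨hmix, hnash⟩, hpos⟩ := hx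
  have hle (t : S i) := hnash i (Pi.single t 1) (single_mem_stdSimplex ℝ t)
  refine (hle s).antisymm ?_
  by_contra! hlt
  have havg := expectedUtility_update u x i i (x i)
  rw [Function.update_eq_self] at havg
  -- The equilibrium payoff averages the pure payoffs, none above it; one below it, having positive
  -- weight, would pull the average down.
  have hsum : ∑ t, x i t * expectedUtility u (Function.update x i (Pi.single t 1)) i <
      ∑ t, x i t * expectedUtility u x i :=
    Finset.sum_lt_sum (fun t _ => mul_le_mul_of_nonneg_left (hle t) (hpos i t).le)
      ⟨s, Finset.mem_univ s, mul_lt_mul_of_pos_left hlt (hpos i s)⟩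
  rw [← Finset.sum_mul, (hmix i).2, one_mul, ← havg] at hsum
  exact hsum.false

lemma IsZeroSum.sum_expectedUtility {u : Profile S → ι → ℝ} (hu : IsZeroSum u)
    (x : (i : ι) → S i → ℝ) : ∑ i, expectedUtility u x i = 0 := by
  simp only [expectedUtility]
  rw [Finset.sum_comm]
  refine Finset.sum_eq_zero fun q _ => ?_
  rw [← Finset.sum_mul, hu q, zero_mul]

lemma IsMixedProfile.sum_prod {x : (i : ι) → S i → ℝ} (hx : IsMixedProfile x) :
    ∑ q : Profile S, ∏ j, x j (q j) = 1 := by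
  rw [← Fintype.prod_sum]
  exact Finset.prod_eq_one fun i _ => (hx i).2

/-- If `u · i ≥ u p i` on all profiles where player `i` plays `p i`, then playing `p i` against `x`
yields at least `u p i`. -/
lemma le_expectedUtility_update_single [∀ i, DecidableEq (S i)] {u : Profile S → ι → ℝ}
    {x : (i : ι) → S i → ℝ} (hx : IsMixedProfile x) {i : ι} {p : Profile S}
    (h : ∀ q, q i = p i → u p i ≤ u q i) :
    u p i ≤ expectedUtility u (Function.update x i (Pi.single (p i) 1)) i := by
  have hsum : u p i = ∑ q : Profile S,
      u p i * ∏ j, Function.update x i (Pi.single (p i) 1) j (q j) := by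
    rw [← Finset.mul_sum, (hx.update i (single_mem_stdSimplex ℝ (p i))).sum_prod, mul_one]
  refine hsum.trans_le ?_
  refine Finset.sum_le_sum fun q _ => ?_
  rw [prod_update_apply]
  by_cases hq : q i = p i
  · rw [hq, Pi.single_eq_same, one_mul]
    exact mul_le_mul_of_nonneg_right (h q hq) (Finset.prod_nonneg fun j _ => (hx j).1 _)
  · simp [Pi.single_eq_of_ne hq]

/-- Full support gives the single strictly better profile `q` positive weight in the average. -/
lemma lt_expectedUtility_update_single [∀ i, DecidableEq (S i)] {u : Profile S → ι → ℝ}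
    {x : (i : ι) → S i → ℝ} (hx : IsMixedProfile x) (hpos : ∀ i s, 0 < x i s) {i : ι}
    {p q : Profile S} (h : ∀ q, q i = p i → u p i ≤ u q i) (hq : q i = p i)
    (hlt : u p i < u q i) :
    u p i < expectedUtility u (Function.update x i (Pi.single (p i) 1)) i := by
  have hsum : u p i = ∑ q : Profile S,
      u p i * ∏ j, Function.update x i (Pi.single (p i) 1) j (q j) := by
    rw [← Finset.mul_sum, (hx.update i (single_mem_stdSimplex ℝ (p i))).sum_prod, mul_one]
  refine hsum.trans_lt ?_
  refine Finset.sum_lt_sum (fun r _ => ?_) ⟨q, Finset.mem_univ q, ?_⟩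
  · rw [prod_update_apply]
    by_cases hr : r i = p i
    · rw [hr, Pi.single_eq_same, one_mul]
      exact mul_le_mul_of_nonneg_right (h r hr) (Finset.prod_nonneg fun j _ => (hx j).1 _)
    · simp [Pi.single_eq_of_ne hr]
  · rw [prod_update_apply, hq, Pi.single_eq_same, one_mul]
    exact mul_lt_mul_of_pos_right hlt (Finset.prod_pos fun j _ => hpos j _)

lemma expectedUtility_neg (u : Profile S → ι → ℝ) (x : (i : ι) → S i → ℝ) (i : ι) :
    expectedUtility (-u) x i = -expectedUtility u x i := by
  simp [expectedUtility]

end General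

section TwoPlayer

variable {S : Fin 2 → Type*} [∀ i, Fintype (S i)] {u : Profile S → Fin 2 → ℝ}

/-- In a two-player zero-sum game with a fully mixed profile that makes both players indifferent,
no profile is strictly better for the deviator than every profile comparable to it. -/
lemma IsZeroSum.not_comparable_of_forall_lt [∀ i, DecidableEq (S i)] (hu : IsZeroSum u)
    {x : (i : Fin 2) → S i → ℝ} (hx : IsMixedProfile x) (hpos : ∀ i s, 0 < x i s)
    (hind : ∀ i s, expectedUtility u (Function.update x i (Pi.single s 1)) i =
      expectedUtility u x i)
    {p : Profile S} (hp : ∀ i q, Comparable i p q → u q i < u p i) (i : Fin 2) (q : Profile S) :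
    ¬ Comparable i p q := by
  intro hpq
  have hz (r : Profile S) (i j : Fin 2) (hij : i ≠ j) : u r i + u r j = 0 := by
    have := hu r
    rw [Fin.sum_univ_two] at this
    fin_cases i <;> fin_cases j <;> simp at hij ⊢ <;> linarith
  have hlt (i j : Fin 2) (hij : i ≠ j) (r : Profile S) (hc : Comparable i p r) :
      u p j < u r j := by
    linarith [hp i r hc, hz p i j hij, hz r i j hij]
  have hge (i j : Fin 2) (hij : i ≠ j) (r : Profile S) (hr : r j = p j) : u p j ≤ u r j := by
    by_cases hri : r i = p i
    · have : r = p := by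
        funext k
        obtain rfl | rfl : k = i ∨ k = j := by omega
        exacts [hri, hr]
      rw [this]
    · refine (hlt i j hij r ⟨Ne.symm hri, fun k hk => ?_⟩).le
      obtain rfl : k = j := by omega
      exact hr.symm
  obtain ⟨j, hij⟩ : ∃ j, i ≠ j := ⟨i + 1, by omega⟩
  have hi := le_expectedUtility_update_single hx (hge j i hij.symm)
  -- Strictness comes from `q`: it is a deviation by `i`, so it keeps `p j` and benefits `j`.
  have hj := lt_expectedUtility_update_single hx hpos (hge i j hij) (hpq.2 j hij.symm).symm
    (hlt i j hij q hpq)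
  rw [hind] at hi hj
  have hsum : expectedUtility u x i + expectedUtility u x j = 0 := by
    have := hu.sum_expectedUtility x
    rw [Fin.sum_univ_two] at this
    fin_cases i <;> fin_cases j <;> simp at hij ⊢ <;> linarith
  linarith [hz p i j hij]

/-- A sink of the response graph has no incoming arcs. -/
lemma IsZeroSum.not_adj_of_isSink (hu : IsZeroSum u) {x : (i : Fin 2) → S i → ℝ}
    (hx : IsInteriorNashEquilibrium u x) {p : Profile S}
    (hp : ∀ q, ¬ (responseGraph u).Adj p q) (q : Profile S) : ¬ (responseGraph u).Adj q p := by
  classical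
  rintro ⟨i, hc, -⟩
  refine hu.not_comparable_of_forall_lt hx.1.1 hx.2 hx.expectedUtility_update_single
    (fun j r hr => ?_) i q hc.symm
  exact lt_of_not_ge fun h => hp r ⟨j, hr, h⟩

/-- A source of the response graph has no outgoing arcs. -/
lemma IsZeroSum.not_adj_of_isSource (hu : IsZeroSum u) {x : (i : Fin 2) → S i → ℝ}
    (hx : IsInteriorNashEquilibrium u x) {p : Profile S}
    (hp : ∀ q, ¬ (responseGraph u).Adj q p) (q : Profile S) : ¬ (responseGraph u).Adj p q := by
  classical
  rintro ⟨i, hc, -⟩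
  -- Indifference, unlike the equilibrium inequality, is visibly preserved by negating `u`.
  refine hu.neg.not_comparable_of_forall_lt hx.1.1 hx.2 (fun j s => ?_) (fun j r hr => ?_) i q hc
  · rw [expectedUtility_neg, expectedUtility_neg, hx.expectedUtility_update_single]
  · exact neg_lt_neg (lt_of_not_ge fun h => hp r ⟨j, hr.symm, h⟩)

end TwoPlayer

lemma innerDiamond_isSink (b : Fin 3 × Fin 3) : ¬ innerDiamond.Adj (1, 1) b := by
  change ((1, 1), b) ∉ innerDiamondArcs
  revert b
  decide

lemma innerDiamond_adj : innerDiamond.Adj (1, 2) (1, 1) := by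
  change ((1, 2), (1, 1)) ∈ innerDiamondArcs
  decide

end GameTheory

theorem mainTheorem9 {S : Fin 2 → Type*} [∀ i, Fintype (S i)]
    (u : GameTheory.Profile S → Fin 2 → ℝ)
    (hzero : GameTheory.IsZeroSum u)
    (heq : ∃ x : (i : Fin 2) → S i → ℝ, GameTheory.IsInteriorNashEquilibrium u x) :
    ¬ GameTheory.DigraphIsomorphic (GameTheory.responseGraph u) GameTheory.innerDiamond ∧
      ¬ GameTheory.DigraphIsomorphic (GameTheory.responseGraph u) GameTheory.outerDiamond := by
  obtain ⟨x, hx⟩ := heq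
  constructor
  · rintro ⟨f, hf⟩
    refine hzero.not_adj_of_isSink hx (p := f.symm (1, 1)) (fun q h => ?_) (f.symm (1, 2)) ?_
    · rw [hf, f.apply_symm_apply] at h
      exact GameTheory.innerDiamond_isSink _ h
    · rw [hf, f.apply_symm_apply, f.apply_symm_apply]
      exact GameTheory.innerDiamond_adj
  · rintro ⟨f, hf⟩
    refine hzero.not_adj_of_isSource hx (p := f.symm (1, 1)) (fun q h => ?_) (f.symm (1, 2)) ?_
    · rw [hf, f.apply_symm_apply] at h
      exact GameTheory.innerDiamond_isSink _ h
    · rw [hf, f.apply_symm_apply, f.apply_symm_apply]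
      exact GameTheory.innerDiamond_adj
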